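/- Let $d$ be a natural number. A density matrix (state) is a positive semidefinite matrix $\rho\in\mathcal M_d(\mathbb C)$ with $\operatorname{tr}\rho=1$. A quantum channel on $\mathcal M_d(\mathbb C)$ is a linear map $\Phi:\mathcal M_d(\mathbb C)\to\mathcal M_d(\mathbb C)$ which is trace preserving and completely positive, i.e. $\Phi\otimes\mathrm{id}_k$ maps positive semidefinite elements of $\mathcal M_d(\mathbb C)\otimes\mathcal M_k(\mathbb C)$ to positive semidefinite elements for every $k\ge 1$. An invariant state of $\Phi$ is a density matrix $\rho$ with $\Phi(\rho)=\rho$. Let $(\Phi_n)_{n\ge 1}$ be a sequence of independent, identically distributed random quantum channels acting on $\mathcal M_d(\mathbb C)$, defined on a probability space $(\Omega,\mathbb P)$, and let $\Phi$ have their common distribution. Assume that $$\mathbb P(\Phi\text{ has a unique invariant state})>0 .$$ Then the entries of $\Phi(X)$ are integrable for every $X\in\mathcal M_d(\mathbb C)$, the (entrywise) expectation $\mathbb E[\Phi]$ is a quantum channel, and $\mathbb E[\Phi]$ has a unique invariant state $\theta$. Moreover, $\mathbb P$-almost surely, $$\lim_{N\to\infty}\frac1N\sum_{n=1}^N[\Phi_n\circ\cdots\circ\Phi_1](\rho_0)=\theta\qquad\text{for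 all density matrices }\rho_0\in\mathcal M_d(\mathbb C).$$ -/

import Mathlib

open MeasureTheory ProbabilityTheory Filter Topology
open scoped ComplexOrder

/-- The algebra `M_d(ℂ)` of complex `d × d` matrices. -/
abbrev MatC (d : ℕ) : Type := Matrix (Fin d) (Fin d) ℂ

/-- Density matrices (states): positive semidefinite (hence self-adjoint) of trace one. -/
def IsDensityMatrix {d : ℕ} (ρ : MatC d) : Prop :=
  ρ.PosSemidef ∧ ρ.trace = 1

/-- The extended map `T ⊗ id_k` on `M_d(ℂ) ⊗ M_k(ℂ)`, whose elements are written as matrices indexed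
by `Fin d × Fin k`: the map `T` is applied to each of the `k × k` blocks, which are `d × d` matrices. -/
def ampliation {d : ℕ} (T : MatC d →ₗ[ℂ] MatC d) (k : ℕ)
    (A : Matrix (Fin d × Fin k) (Fin d × Fin k) ℂ) :
    Matrix (Fin d × Fin k) (Fin d × Fin k) ℂ :=
  Matrix.of fun p q => T (Matrix.of fun i j => A (i, p.2) (j, q.2)) p.1 q.1

/-- `T` is completely positive: `T ⊗ id_k` maps positive semidefinite matrices to positive
semidefinite matrices, for every `k`. -/
def IsCompletelyPositive {d : ℕ} (T : MatC d →ₗ[ℂ] MatC d) : Prop :=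
  ∀ (k : ℕ) (A : Matrix (Fin d × Fin k) (Fin d × Fin k) ℂ),
    A.PosSemidef → (ampliation T k A).PosSemidef

/-- `T` is trace preserving. -/
def IsTracePreserving {d : ℕ} (T : MatC d →ₗ[ℂ] MatC d) : Prop :=
  ∀ X : MatC d, (T X).trace = X.trace

/-- A quantum channel is a completely positive, trace preserving linear map. -/
def IsQuantumChannel {d : ℕ} (T : MatC d →ₗ[ℂ] MatC d) : Prop :=
  IsCompletelyPositive T ∧ IsTracePreserving T

/-- The type of quantum channels acting on `M_d(ℂ)`. -/
abbrev QuantumChannel (d : ℕ) : Type := {T : MatC d →ₗ[ℂ] MatC d // IsQuantumChannel T}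

/-- `ρ` is an invariant state of `T`. -/
def IsInvariantState {d : ℕ} (T : MatC d →ₗ[ℂ] MatC d) (ρ : MatC d) : Prop :=
  IsDensityMatrix ρ ∧ T ρ = ρ

/-- The σ-algebra on the linear maps of `M_d(ℂ)` generated by all the entries `T ↦ (T X) i j`; this
is the Borel σ-algebra of that finite dimensional space. Channels carry the induced σ-algebra. -/
noncomputable instance instMeasurableSpaceMatCEnd (d : ℕ) : MeasurableSpace (MatC d →ₗ[ℂ] MatC d) :=
  MeasurableSpace.comap
    (fun (T : MatC d →ₗ[ℂ] MatC d) (X : MatC d) (i j : Fin d) => T X i j) MeasurableSpace.pi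

/-- The expectation `𝔼[T]` of a random linear map of `M_d(ℂ)`: the linear map whose matrix, in the
basis of matrix units, is the entrywise expectation of the matrix of `T`. -/
noncomputable def expectedMap {d : ℕ} {Ω : Type*} [MeasurableSpace Ω] (P : Measure Ω)
    (T : Ω → (MatC d →ₗ[ℂ] MatC d)) : MatC d →ₗ[ℂ] MatC d :=
  Matrix.toLin (Matrix.stdBasis ℂ (Fin d) (Fin d)) (Matrix.stdBasis ℂ (Fin d) (Fin d))
    (Matrix.of fun p q => ∫ ω, LinearMap.toMatrix (Matrix.stdBasis ℂ (Fin d) (Fin d))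
      (Matrix.stdBasis ℂ (Fin d) (Fin d)) (T ω) p q ∂P)

/-- The composition `T (n - 1) ∘ ⋯ ∘ T 1 ∘ T 0` of the first `n` maps of a sequence. -/
def composeFirst {d : ℕ} (T : ℕ → (MatC d →ₗ[ℂ] MatC d)) : ℕ → (MatC d →ₗ[ℂ] MatC d)
  | 0 => LinearMap.id
  | n + 1 => T n ∘ₗ composeFirst T n

/-! Write E for the expected channel. For uniqueness, suppose E had two invariant states; their
difference H is a nonzero traceless Hermitian fixed point. Let p be the support projection of the
positive part of H. Positivity and trace preservation force tr((1 - p) E(p)) = 0. This is the mean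
of the nonnegative variable tr((1 - p) Φ(p)), so almost every Φ preserves the corner cut out by p,
and Cesàro averaging inside that corner yields an invariant state ρ of Φ with tr(Hρ) > 0
(`ae_exists_isInvariantState`). Applied to -H as well, this gives almost every Φ two distinct
invariant states, which the hypothesis excludes (`expectedMap_isInvariantState_unique`).

For convergence, the conditional mean of the next state given the past is E of the current one. The
differences are therefore bounded and orthogonal (`integral_mul_innovation`), and a strong law
(`ae_tendsto_average_of_orthogonal`) makes their averages vanish almost surely. So the averaged
states are asymptotically E-invariant (`tendsto_average_sub_map`): every cluster point is an
invariant state, hence θ, and compactness of the set of states gives the limit. -/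

/-! ### Positive trace preserving maps, uniform bounds, compactness of states. -/

/-- Positive, trace preserving maps of `M_d(ℂ)`. -/
def IsPositiveTP {d : ℕ} (T : MatC d →ₗ[ℂ] MatC d) : Prop :=
  (∀ A : MatC d, A.PosSemidef → (T A).PosSemidef) ∧ IsTracePreserving T

/-- The case `k = 1`, with `Fin d × Fin 1` identified with `Fin d`. Complete positivity itself is
needed again only to see that the expectation is a channel. -/
theorem IsQuantumChannel.isPositiveTP {d : ℕ} {T : MatC d →ₗ[ℂ] MatC d}
    (hT : IsQuantumChannel T) : IsPositiveTP T := by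
  refine ⟨fun A hA => ?_, hT.2⟩
  exact (hT.1 1 (A.submatrix Prod.fst Prod.fst) (hA.submatrix _)).submatrix fun i => (i, 0)

theorem IsPositiveTP.id {d : ℕ} : IsPositiveTP (LinearMap.id : MatC d →ₗ[ℂ] MatC d) :=
  ⟨fun _ h => h, fun _ => rfl⟩

theorem IsPositiveTP.comp {d : ℕ} {S T : MatC d →ₗ[ℂ] MatC d} (hS : IsPositiveTP S)
    (hT : IsPositiveTP T) : IsPositiveTP (S ∘ₗ T) :=
  ⟨fun A hA => hS.1 _ (hT.1 A hA), fun X => (hS.2 _).trans (hT.2 X)⟩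

theorem IsPositiveTP.pow {d : ℕ} {T : MatC d →ₗ[ℂ] MatC d} (hT : IsPositiveTP T) (n : ℕ) :
    IsPositiveTP (T ^ n) := by
  induction n with
  | zero => exact .id
  | succ n ih => rw [pow_succ']; exact hT.comp ih

theorem IsPositiveTP.composeFirst {d : ℕ} {T : ℕ → (MatC d →ₗ[ℂ] MatC d)}
    (hT : ∀ n, IsPositiveTP (T n)) (n : ℕ) : IsPositiveTP (composeFirst T n) := by
  induction n with
  | zero => exact .id
  | succ n ih => exact (hT n).comp ih

theorem IsPositiveTP.isDensityMatrix {d : ℕ} {T : MatC d →ₗ[ℂ] MatC d} (hT : IsPositiveTP T)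
    {ρ : MatC d} (h : IsDensityMatrix ρ) : IsDensityMatrix (T ρ) :=
  ⟨hT.1 _ h.1, (hT.2 _).trans h.2⟩

open scoped MatrixOrder Matrix.Norms.L2Operator in
theorem Matrix.PosSemidef.exists_conjTranspose_mul_self {d : ℕ} {A : MatC d} (hA : A.PosSemidef) :
    ∃ B : MatC d, A = B.conjTranspose * B :=
  CStarAlgebra.nonneg_iff_eq_star_mul_self.1 (Matrix.nonneg_iff_posSemidef.2 hA)

open scoped MatrixOrder Matrix.Norms.L2Operator in
theorem Matrix.PosSemidef.exists_le_smul_one {d : ℕ} {A : MatC d} (hA : A.PosSemidef) :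
    ∃ c : ℝ, 0 ≤ c ∧ ((c : ℂ) • (1 : MatC d) - A).PosSemidef := by
  refine ⟨‖A‖, norm_nonneg _, ?_⟩
  have h : A ≤ algebraMap ℝ (MatC d) ‖A‖ := IsSelfAdjoint.le_algebraMap_norm_self (ha := hA.1)
  rw [Matrix.le_iff, Algebra.algebraMap_eq_smul_one] at h
  convert! h using 2

open scoped MatrixOrder Matrix.Norms.L2Operator in
theorem Matrix.span_posSemidef {d : ℕ} :
    Submodule.span ℂ {A : MatC d | A.PosSemidef} = ⊤ := by
  rw [← CStarAlgebra.span_nonneg]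
  congr 1
  ext A
  exact Matrix.nonneg_iff_posSemidef.symm

/-- Writing `A` as a Gram matrix, this is the inequality ab ≤ (a² + b²)/2 applied to each row of
`B`. -/
theorem Matrix.PosSemidef.norm_apply_le {d : ℕ} {A : MatC d} (hA : A.PosSemidef) (i j : Fin d) :
    ‖A i j‖ ≤ ‖A.trace‖ := by
  obtain ⟨B, rfl⟩ := hA.exists_conjTranspose_mul_self
  have htr : (B.conjTranspose * B).trace = ((∑ l, ∑ k, ‖B k l‖ ^ 2 : ℝ) : ℂ) := by
    simp [Matrix.trace, Matrix.mul_apply, ← Complex.normSq_eq_norm_sq, Complex.normSq_eq_conj_mul_self]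
  rw [htr, Complex.norm_of_nonneg (by positivity), Finset.sum_comm, Matrix.mul_apply]
  refine (norm_sum_le _ _).trans (Finset.sum_le_sum fun k _ => ?_)
  have h1 : ∀ l, ‖B k l‖ ^ 2 ≤ ∑ l, ‖B k l‖ ^ 2 := fun l =>
    Finset.single_le_sum (f := fun l => ‖B k l‖ ^ 2) (fun _ _ => by positivity) (Finset.mem_univ l)
  rw [Matrix.conjTranspose_apply, norm_mul, norm_star]
  nlinarith [h1 i, h1 j, sq_nonneg (‖B k i‖ - ‖B k j‖)]

/-- On a positive semidefinite matrix the preserved trace controls all entries of the image, and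
such matrices span. Uniformity in `T` supplies both integrability and the bounds for the strong law.
-/
theorem exists_forall_norm_apply_le {d : ℕ} (X : MatC d) :
    ∃ C : ℝ, ∀ T : MatC d →ₗ[ℂ] MatC d, IsPositiveTP T → ∀ i j, ‖T X i j‖ ≤ C := by
  have hX : X ∈ Submodule.span ℂ {A : MatC d | A.PosSemidef} := by
    rw [Matrix.span_posSemidef]; trivial
  induction hX using Submodule.span_induction with
  | mem A hA =>
    refine ⟨‖A.trace‖, fun T hT i j => ?_⟩
    rw [← hT.2 A]
    exact (hT.1 A hA).norm_apply_le i j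
  | zero => exact ⟨0, fun T _ i j => by simp⟩
  | add A B _ _ hA hB =>
    obtain ⟨a, ha⟩ := hA
    obtain ⟨b, hb⟩ := hB
    refine ⟨a + b, fun T hT i j => ?_⟩
    rw [map_add]
    exact (norm_add_le _ _).trans (add_le_add (ha T hT i j) (hb T hT i j))
  | smul c A _ hA =>
    obtain ⟨a, ha⟩ := hA
    refine ⟨‖c‖ * a, fun T hT i j => ?_⟩
    rw [map_smul, Matrix.smul_apply, norm_smul]
    exact mul_le_mul_of_nonneg_left (ha T hT i j) (norm_nonneg _)

theorem Matrix.isClosed_posSemidef {d : ℕ} : IsClosed {A : MatC d | A.PosSemidef} := by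
  simp only [Matrix.posSemidef_iff_dotProduct_mulVec, Set.ofPred_and, Set.ofPred_forall]
  refine IsClosed.inter (isClosed_eq (by fun_prop) continuous_id)
    (isClosed_iInter fun x => ?_)
  have h : Continuous fun A : MatC d => star x ⬝ᵥ (A.mulVec x) := by fun_prop
  exact isClosed_Ici.preimage h

theorem isCompact_isDensityMatrix {d : ℕ} : IsCompact {ρ : MatC d | IsDensityMatrix ρ} := by
  have hK : IsCompact (Set.pi Set.univ fun _ : Fin d => Set.pi Set.univ fun _ : Fin d =>
      Metric.closedBall (0 : ℂ) 1) :=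
    isCompact_univ_pi fun _ => isCompact_univ_pi fun _ => isCompact_closedBall _ _
  refine IsCompact.of_isClosed_subset (t := {ρ : MatC d | IsDensityMatrix ρ}) hK ?_ ?_
  · exact Matrix.isClosed_posSemidef.inter (isClosed_eq (by fun_prop) continuous_const)
  · intro ρ hρ i _ j _
    have := hρ.1.norm_apply_le i j
    rw [hρ.2, norm_one] at this
    simpa using this

/-! ### Cesàro averages and invariant states. -/

/-- The average of finitely many density matrices is a density matrix. -/
theorem isDensityMatrix_average {d : ℕ} {ρ : ℕ → MatC d} (hρ : ∀ n, IsDensityMatrix (ρ n))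
    (s : Finset ℕ) (hs : s.Nonempty) :
    IsDensityMatrix ((s.card : ℂ)⁻¹ • ∑ n ∈ s, ρ n) := by
  have hc : (s.card : ℂ) ≠ 0 := by exact_mod_cast hs.card_pos.ne'
  refine ⟨Matrix.PosSemidef.smul (Matrix.posSemidef_sum _ fun n _ => (hρ n).1) ?_, ?_⟩
  · have : (0 : ℂ) ≤ ((s.card : ℝ)⁻¹ : ℝ) := by
      rw [Complex.zero_le_real]; positivity
    simpa only [Complex.ofReal_inv, Complex.ofReal_natCast] using this
  · rw [Matrix.trace_smul, Matrix.trace_sum, Finset.sum_congr rfl fun n _ => (hρ n).2]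
    simp [hc]

/-- A cluster point of an asymptotically invariant sequence is invariant. -/
theorem map_eq_of_mapClusterPt {d : ℕ} {T : MatC d →ₗ[ℂ] MatC d} {A : ℕ → MatC d}
    (h : Tendsto (fun N => A N - T (A N)) atTop (𝓝 0)) {ρ : MatC d}
    (hρ : MapClusterPt ρ atTop A) : T ρ = ρ := by
  have hT : Continuous T := LinearMap.continuous_of_finiteDimensional T
  have h1 : MapClusterPt (ρ - T ρ) atTop (fun N => A N - T (A N)) :=
    hρ.continuousAt_comp (f := fun X => X - T X) (by fun_prop)
  have : ρ - T ρ = 0 := by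
    by_contra hne
    exact hne (eq_of_nhds_neBot (ClusterPt.mono h1 h))
  exact (sub_eq_zero.1 this).symm

theorem tendsto_inv_smul_of_bounded {d : ℕ} {X : ℕ → MatC d} {C : ℝ}
    (hX : ∀ n i j, ‖X n i j‖ ≤ C) : Tendsto (fun N : ℕ => (N : ℂ)⁻¹ • X N) atTop (𝓝 0) := by
  refine tendsto_pi_nhds.2 fun i => tendsto_pi_nhds.2 fun j => ?_
  have h0 : Tendsto (fun N : ℕ => (N : ℝ)⁻¹ * C) atTop (𝓝 0) := by
    simpa using (tendsto_inv_atTop_nhds_zero_nat (𝕜 := ℝ)).mul_const C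
  refine squeeze_zero_norm (fun N => ?_) h0
  rw [Matrix.smul_apply, norm_smul, norm_inv, Complex.norm_natCast]
  exact mul_le_mul_of_nonneg_left (hX N i j) (by positivity)

/-- Cesàro averages of an orbit produce an invariant state, and keep a linear constraint that holds
along the orbit. -/
theorem exists_isInvariantState_of_orbit {d : ℕ} {T : MatC d →ₗ[ℂ] MatC d} (hT : IsPositiveTP T)
    {σ : MatC d} (hσ : IsDensityMatrix σ) (Q : MatC d) (hQ : ∀ n, (Q * (T ^ n) σ).trace = 0) :
    ∃ ρ, IsInvariantState T ρ ∧ (Q * ρ).trace = 0 := by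
  set A : ℕ → MatC d := fun N => (N : ℂ)⁻¹ • ∑ n ∈ Finset.range N, (T ^ n) σ with hA
  have hdens : ∀ n, IsDensityMatrix ((T ^ n) σ) := fun n => (hT.pow n).isDensityMatrix hσ
  have hK : IsCompact {ρ : MatC d | IsDensityMatrix ρ ∧ (Q * ρ).trace = 0} :=
    isCompact_isDensityMatrix.inter_right (isClosed_eq (by fun_prop) continuous_const)
  have hmem : ∀ᶠ N in atTop, A N ∈ {ρ : MatC d | IsDensityMatrix ρ ∧ (Q * ρ).trace = 0} := by
    filter_upwards [eventually_ge_atTop 1] with N hN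
    refine ⟨?_, ?_⟩
    · simpa using isDensityMatrix_average hdens (Finset.range N)
        (Finset.nonempty_range_iff.2 (by omega))
    · simp [hA, Finset.mul_sum, Matrix.trace_sum, hQ]
  obtain ⟨ρ, hρ, hcl⟩ := hK.exists_mapClusterPt_of_frequently hmem.frequently
  refine ⟨ρ, ⟨hρ.1, map_eq_of_mapClusterPt ?_ hcl⟩, hρ.2⟩
  -- Telescoping leaves two boundary terms, both states, whence the bound 2 below.
  have hdiff : ∀ N, A N - T (A N) = (N : ℂ)⁻¹ • (σ - (T ^ N) σ) := by
    intro N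
    rw [hA]
    simp only [map_smul, map_sum, ← smul_sub, ← Finset.sum_sub_distrib]
    congr 1
    have := Finset.sum_range_sub' (fun n => (T ^ n) σ) N
    simpa [pow_succ'] using this
  simp only [hdiff]
  refine tendsto_inv_smul_of_bounded (C := 2) fun n i j => ?_
  have h1 := hσ.1.norm_apply_le i j
  have h2 := (hdens n).1.norm_apply_le i j
  rw [hσ.2, norm_one] at h1
  rw [(hdens n).2, norm_one] at h2
  exact (norm_sub_le _ _).trans (by linarith)

/-! ### Positive parts, supports and invariant corners. -/

theorem Matrix.PosSemidef.trace_mul_nonneg {d : ℕ} {A B : MatC d} (hA : A.PosSemidef)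
    (hB : B.PosSemidef) : 0 ≤ (A * B).trace := by
  obtain ⟨C, rfl⟩ := hA.exists_conjTranspose_mul_self
  rw [Matrix.mul_assoc, Matrix.trace_mul_comm]
  exact (hB.mul_mul_conjTranspose_same C).trace_nonneg

/-- With Gram factors `C` and `D`, the trace is the squared Hilbert–Schmidt norm of `C *
D.conjTranspose`. -/
theorem Matrix.PosSemidef.mul_eq_zero_of_trace {d : ℕ} {A B : MatC d} (hA : A.PosSemidef)
    (hB : B.PosSemidef) (h : (A * B).trace = 0) : A * B = 0 := by
  obtain ⟨C, rfl⟩ := hA.exists_conjTranspose_mul_self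
  obtain ⟨D, rfl⟩ := hB.exists_conjTranspose_mul_self
  have h1 : C * D.conjTranspose = 0 := by
    rw [← Matrix.trace_mul_conjTranspose_self_eq_zero_iff, ← h, Matrix.mul_assoc C.conjTranspose,
      Matrix.trace_mul_comm C.conjTranspose]
    simp [Matrix.mul_assoc]
  calc C.conjTranspose * C * (D.conjTranspose * D)
      = C.conjTranspose * (C * D.conjTranspose) * D := by simp only [Matrix.mul_assoc]
    _ = 0 := by rw [h1]; simp

/-- The decomposition of a Hermitian matrix `H` into its positive part `A` and its negative part
`B`, together with the projection `p` onto the support of `A`. -/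
structure IsPosNegDecomposition {d : ℕ} (H p A B : MatC d) : Prop where
  eq_sub : H = A - B
  posSemidef_pos : A.PosSemidef
  posSemidef_neg : B.PosSemidef
  posSemidef_proj : p.PosSemidef
  posSemidef_compl : (1 - p).PosSemidef
  proj_mul_self : p * p = p
  proj_mul_pos : p * A = A
  proj_mul_neg : p * B = 0
  exists_le : ∃ c : ℝ, 0 < c ∧ ((c : ℂ) • A - p).PosSemidef

theorem Matrix.IsHermitian.exists_isPosNegDecomposition {d : ℕ} {H : MatC d}
    (hH : H.IsHermitian) : ∃ p A B, IsPosNegDecomposition H p A B := by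
  set φ := Unitary.conjStarAlgAut ℂ (MatC d) hH.eigenvectorUnitary with hφ
  set v := hH.eigenvalues
  have hpos : ∀ f : Fin d → ℝ, (∀ i, 0 ≤ f i) →
      (φ (Matrix.diagonal fun i => (f i : ℂ))).PosSemidef := fun f hf =>
    (Matrix.PosSemidef.diagonal (d := fun i => (f i : ℂ)) fun i =>
      Complex.zero_le_real.2 (hf i)).mul_mul_conjTranspose_same _
  -- In an eigenbasis, `χ` selects the strictly positive eigenvalues, so `p` is exactly the support
  -- of `A`.
  let χ : Fin d → ℝ := fun i => if 0 < v i then 1 else 0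
  refine ⟨φ (Matrix.diagonal fun i => (χ i : ℂ)), φ (Matrix.diagonal fun i => ((max (v i) 0 : ℝ) : ℂ)),
    φ (Matrix.diagonal fun i => ((max (-v i) 0 : ℝ) : ℂ)), ?_, hpos _ (by simp), hpos _ (by simp),
    hpos _ ?_, ?_, ?_, ?_, ?_, ?_⟩
  · rw [← map_sub, Matrix.diagonal_sub]
    conv_lhs => rw [hH.spectral_theorem]
    rw [hφ]
    congr 2
    ext i
    change ((v i : ℝ) : ℂ) = _
    norm_cast
    rcases le_total (v i) 0 with h | h <;> simp [h]
  · intro i; by_cases h : 0 < v i <;> simp [χ, h]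
  · have : (1 : MatC d) - φ (Matrix.diagonal fun i => (χ i : ℂ)) =
        φ (Matrix.diagonal fun i => ((1 - χ i : ℝ) : ℂ)) := by
      rw [← map_one φ, ← map_sub, ← Matrix.diagonal_one, Matrix.diagonal_sub]
      simp
    rw [this]
    refine hpos _ fun i => ?_
    by_cases h : 0 < v i <;> simp [χ, h]
  · rw [← map_mul, Matrix.diagonal_mul_diagonal]
    congr 2
    ext i
    by_cases h : 0 < v i <;> simp [χ, h]
  · rw [← map_mul, Matrix.diagonal_mul_diagonal]
    congr 2
    ext i
    by_cases h : 0 < v i <;> simp [χ, h]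
    rw [max_eq_right (not_lt.1 h), Complex.ofReal_zero]
  · rw [← map_mul, Matrix.diagonal_mul_diagonal, ← map_zero φ, ← Matrix.diagonal_zero]
    congr 2
    ext i
    by_cases h : 0 < v i <;> simp [χ, h]
    exact h.le
  · obtain ⟨c, hc0, hc⟩ : ∃ c : ℝ, 0 < c ∧ ∀ i, χ i ≤ c * max (v i) 0 := by
      -- The sum dominates the inverse of each positive eigenvalue; zero eigenvalues contribute `0⁻¹
      -- = 0`, and the 1 makes the constant positive.
      refine ⟨1 + ∑ i, |v i|⁻¹, by positivity, fun i => ?_⟩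
      by_cases h : 0 < v i
      · simp only [χ, h, if_true, max_eq_left h.le]
        have h1 : |v i|⁻¹ ≤ ∑ i, |v i|⁻¹ := Finset.single_le_sum (f := fun i => |v i|⁻¹)
          (fun _ _ => by positivity) (Finset.mem_univ i)
        calc 1 = |v i|⁻¹ * v i := by rw [abs_of_pos h, inv_mul_cancel₀ h.ne']
          _ ≤ _ := mul_le_mul_of_nonneg_right (by linarith) h.le
      · simp only [χ, h, if_false]
        positivity
    refine ⟨c, hc0, ?_⟩
    rw [← map_smul, ← map_sub]
    convert! hpos (fun i => c * max (v i) 0 - χ i) fun i => sub_nonneg.2 (hc i) using 2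
    rw [← Matrix.diagonal_smul, Matrix.diagonal_sub]
    congr 1
    ext i
    simp

namespace IsPosNegDecomposition

variable {d : ℕ} {H p A B : MatC d}

theorem compl_mul_proj (h : IsPosNegDecomposition H p A B) : (1 - p) * p = 0 := by
  rw [sub_mul, one_mul, h.proj_mul_self, sub_self]

theorem proj_ne_zero (h : IsPosNegDecomposition H p A B) (hH : H ≠ 0) (htr : H.trace = 0) :
    p ≠ 0 := by
  rintro rfl
  have hA : A = 0 := by rw [← h.proj_mul_pos, zero_mul]
  have hHB := h.eq_sub
  rw [hA, zero_sub] at hHB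
  rw [hHB, Matrix.trace_neg, neg_eq_zero, h.posSemidef_neg.trace_eq_zero_iff] at htr
  exact hH (by rw [hHB, htr, neg_zero])

/-- A positive, trace preserving map that fixes `H` leaks nothing out of the support of the positive
part of `H`. -/
theorem trace_compl_mul_map_eq_zero (h : IsPosNegDecomposition H p A B)
    {T : MatC d →ₗ[ℂ] MatC d} (hT : IsPositiveTP T) (hTH : T H = H) :
    ((1 - p) * T p).trace = 0 := by
  have hA : ((1 - p) * T A).trace = 0 := by
    refine le_antisymm ?_ (h.posSemidef_compl.trace_mul_nonneg (hT.1 _ h.posSemidef_pos))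
    -- Compressing `T H = H` by `p` shows that `T A` has at least the trace of `A` inside `p`; since
    -- its total trace equals that of `A`, nothing remains outside.
    have h1 : (p * T A).trace - (p * T B).trace = A.trace := by
      rw [← Matrix.trace_sub, ← mul_sub, ← map_sub, ← h.eq_sub, hTH, h.eq_sub, mul_sub,
        h.proj_mul_pos, h.proj_mul_neg, sub_zero]
    have h2 := h.posSemidef_proj.trace_mul_nonneg (hT.1 _ h.posSemidef_neg)
    have h3 : ((1 - p) * T A).trace = -(p * T B).trace := by
      rw [sub_mul, one_mul, Matrix.trace_sub, hT.2, ← h1]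
      ring
    rw [h3]
    exact neg_nonpos.2 h2
  -- Domination of `p` by a multiple of `A` carries the vanishing from `T A` to `T p`.
  obtain ⟨c, -, hc⟩ := h.exists_le
  refine le_antisymm ?_ (h.posSemidef_compl.trace_mul_nonneg (hT.1 _ h.posSemidef_proj))
  have h4 := h.posSemidef_compl.trace_mul_nonneg (hT.1 _ hc)
  rw [map_sub, map_smul, mul_sub, Matrix.mul_smul, Matrix.trace_sub, Matrix.trace_smul, hA,
    smul_zero, zero_sub] at h4
  exact neg_nonneg.1 h4

/-- The hypothesis kills `(1 - p) * T p`, so `T p` equals its compression by `p`; compressing a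
scalar bound for `T p` then turns the identity into `p`. -/
theorem exists_map_le (h : IsPosNegDecomposition H p A B)
    {T : MatC d →ₗ[ℂ] MatC d} (hT : IsPositiveTP T) (hp : ((1 - p) * T p).trace = 0) :
    ∃ c : ℝ, 0 ≤ c ∧ ((c : ℂ) • p - T p).PosSemidef := by
  have hTp := hT.1 _ h.posSemidef_proj
  have h1 : p * T p = T p := by
    have := h.posSemidef_compl.mul_eq_zero_of_trace hTp hp
    rw [sub_mul, one_mul, sub_eq_zero] at this
    exact this.symm
  have h2 : T p * p = T p := by
    have := congrArg Matrix.conjTranspose h1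
    rwa [Matrix.conjTranspose_mul, hTp.1.eq, h.posSemidef_proj.1.eq] at this
  obtain ⟨c, hc0, hc⟩ := hTp.exists_le_smul_one
  refine ⟨c, hc0, ?_⟩
  have h3 := hc.mul_mul_conjTranspose_same p
  rwa [h.posSemidef_proj.1.eq, mul_sub, sub_mul, h1, h2, Matrix.mul_smul, mul_one,
    Matrix.smul_mul, h.proj_mul_self] at h3

theorem exists_pow_le (h : IsPosNegDecomposition H p A B)
    {T : MatC d →ₗ[ℂ] MatC d} (hT : IsPositiveTP T) (hp : ((1 - p) * T p).trace = 0) (n : ℕ) :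
    ∃ c : ℝ, 0 ≤ c ∧ ((c : ℂ) • p - (T ^ n) p).PosSemidef := by
  obtain ⟨a, ha0, ha⟩ := h.exists_map_le hT hp
  induction n with
  | zero => exact ⟨1, zero_le_one, by simpa using Matrix.PosSemidef.zero⟩
  | succ n ih =>
    obtain ⟨c, hc0, hc⟩ := ih
    refine ⟨c * a, by positivity, ?_⟩
    have h1 := (hT.1 _ hc).add (Matrix.PosSemidef.smul ha (Complex.zero_le_real.2 hc0))
    convert! h1 using 1
    rw [pow_succ', map_sub, map_smul, smul_sub, smul_smul, Complex.ofReal_mul]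
    simp

/-- The orbit of the normalised projection never leaves the corner of `p`, so its Cesàro limit `ρ`
is supported there. On that corner `H` acts as `A`, which is bounded below by a positive multiple of
`p`. -/
theorem exists_isInvariantState (h : IsPosNegDecomposition H p A B) (hH : H ≠ 0)
    (htr : H.trace = 0) {T : MatC d →ₗ[ℂ] MatC d} (hT : IsPositiveTP T)
    (hp : ((1 - p) * T p).trace = 0) :
    ∃ ρ, IsInvariantState T ρ ∧ 0 < (H * ρ).trace := by
  have hp0 : p.trace ≠ 0 := fun h0 =>
    h.proj_ne_zero hH htr (h.posSemidef_proj.trace_eq_zero_iff.1 h0)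
  have hpnn := h.posSemidef_proj.trace_nonneg
  have hσ : IsDensityMatrix (p.trace⁻¹ • p) := by
    refine ⟨h.posSemidef_proj.smul (inv_nonneg.2 hpnn), ?_⟩
    rw [Matrix.trace_smul, smul_eq_mul, inv_mul_cancel₀ hp0]
  have horb : ∀ n, ((1 - p) * (T ^ n) (p.trace⁻¹ • p)).trace = 0 := by
    intro n
    obtain ⟨c, -, hc⟩ := h.exists_pow_le hT hp n
    have h1 : ((1 - p) * (T ^ n) p).trace = 0 := by
      refine le_antisymm ?_ (h.posSemidef_compl.trace_mul_nonneg
        ((hT.pow n).1 _ h.posSemidef_proj))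
      have h2 := h.posSemidef_compl.trace_mul_nonneg hc
      rw [mul_sub, Matrix.mul_smul, h.compl_mul_proj, smul_zero, zero_sub, Matrix.trace_neg] at h2
      exact neg_nonneg.1 h2
    rw [map_smul, Matrix.mul_smul, Matrix.trace_smul, h1, smul_zero]
  obtain ⟨ρ, hρ, htrρ⟩ := exists_isInvariantState_of_orbit hT hσ (1 - p) horb
  refine ⟨ρ, hρ, ?_⟩
  have hpρ : p * ρ = ρ := by
    have := h.posSemidef_compl.mul_eq_zero_of_trace hρ.1.1 htrρ
    rw [sub_mul, one_mul, sub_eq_zero] at this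
    exact this.symm
  have hBp : B * p = 0 := by
    have := congrArg Matrix.conjTranspose h.proj_mul_neg
    rwa [Matrix.conjTranspose_mul, h.posSemidef_neg.1.eq, h.posSemidef_proj.1.eq,
      Matrix.conjTranspose_zero] at this
  have hHρ : (H * ρ).trace = (A * ρ).trace := by
    have : B * ρ = 0 := by rw [← hpρ, ← mul_assoc, hBp, zero_mul]
    rw [h.eq_sub, sub_mul, this, sub_zero]
  -- Since tr(pρ) = 1, domination of `p` by `c` times `A` gives 1 ≤ c tr(Aρ).
  obtain ⟨c, hc0, hc⟩ := h.exists_le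
  have h5 := hc.trace_mul_nonneg hρ.1.1
  rw [sub_mul, hpρ, Matrix.smul_mul, Matrix.trace_sub, hρ.1.2, Matrix.trace_smul, smul_eq_mul,
    sub_nonneg] at h5
  rw [hHρ]
  refine lt_of_le_of_ne (h.posSemidef_pos.trace_mul_nonneg hρ.1.1) fun h0 => ?_
  rw [← h0, mul_zero] at h5
  exact (zero_lt_one' ℂ).not_ge h5

end IsPosNegDecomposition

/-! ### The expected channel. -/

theorem measurable_map_apply {d : ℕ} {Ω : Type*} {m : MeasurableSpace Ω} {Φ : Ω → QuantumChannel d}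
    (h : Measurable Φ) (X : MatC d) (i j : Fin d) : Measurable fun ω => (Φ ω).1 X i j := by
  have h1 : Measurable fun (T : MatC d →ₗ[ℂ] MatC d) (X : MatC d) (i j : Fin d) => T X i j :=
    comap_measurable _
  have h2 : Measurable fun ω => (Φ ω).1 := measurable_subtype_coe.comp h
  exact (measurable_pi_apply j).comp ((measurable_pi_apply i).comp
    ((measurable_pi_apply X).comp (h1.comp h2)))

section Expectation

variable {d : ℕ} {Ω : Type*} [MeasurableSpace Ω] {P : Measure Ω} [IsProbabilityMeasure P]

theorem integrable_of_bounded {f : Ω → ℂ} (hf : Measurable f) {C : ℝ} (hC : ∀ ω, ‖f ω‖ ≤ C) :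
    Integrable f P :=
  Integrable.of_bound hf.aestronglyMeasurable C (ae_of_all _ hC)

theorem integrable_map_apply {Φ : Ω → QuantumChannel d} (h : Measurable Φ) (X : MatC d)
    (i j : Fin d) : Integrable (fun ω => (Φ ω).1 X i j) P := by
  obtain ⟨C, hC⟩ := exists_forall_norm_apply_le X
  exact integrable_of_bounded (measurable_map_apply h X i j)
    fun ω => hC _ (Φ ω).2.isPositiveTP i j

theorem Matrix.stdBasis_repr_apply (X : MatC d) (q : Fin d × Fin d) :
    (Matrix.stdBasis ℂ (Fin d) (Fin d)).repr X q = X q.1 q.2 := by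
  simp [Matrix.stdBasis, Pi.basis_repr]

theorem Matrix.linearMap_apply_eq_sum (T : MatC d →ₗ[ℂ] MatC d) (X : MatC d) (i j : Fin d) :
    T X i j = ∑ q : Fin d × Fin d, X q.1 q.2 * T (Matrix.stdBasis ℂ (Fin d) (Fin d) q) i j := by
  conv_lhs => rw [← (Matrix.stdBasis ℂ (Fin d) (Fin d)).sum_repr X]
  rw [map_sum, Matrix.sum_apply]
  simp only [map_smul, Matrix.smul_apply, smul_eq_mul, Matrix.stdBasis_repr_apply]

theorem expectedMap_apply {Φ : Ω → QuantumChannel d} (h : Measurable Φ) (X : MatC d)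
    (i j : Fin d) :
    expectedMap P (fun ω => (Φ ω).1) X i j = ∫ ω, (Φ ω).1 X i j ∂P := by
  have hb : ∀ q, expectedMap P (fun ω => (Φ ω).1) (Matrix.stdBasis ℂ (Fin d) (Fin d) q) i j =
      ∫ ω, (Φ ω).1 (Matrix.stdBasis ℂ (Fin d) (Fin d) q) i j ∂P := by
    intro q
    rw [← Matrix.stdBasis_repr_apply (expectedMap P _ _) (i, j), ← LinearMap.toMatrix_apply,
      expectedMap, LinearMap.toMatrix_toLin, Matrix.of_apply]
    simp only [LinearMap.toMatrix_apply, Matrix.stdBasis_repr_apply]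
  rw [Matrix.linearMap_apply_eq_sum]
  simp only [hb, Matrix.linearMap_apply_eq_sum _ X]
  rw [integral_finsetSum _ fun q _ => (integrable_map_apply h _ i j).const_mul _]
  simp only [integral_const_mul]

end Expectation

section Expectation

variable {d : ℕ} {Ω : Type*} [MeasurableSpace Ω] {P : Measure Ω}

theorem Matrix.posSemidef_integral {n : Type*} [Fintype n] {M : Ω → Matrix n n ℂ}
    (hint : ∀ i j, Integrable (fun ω => M ω i j) P) (hM : ∀ ω, (M ω).PosSemidef) :
    (Matrix.of fun i j => ∫ ω, M ω i j ∂P).PosSemidef := by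
  refine Matrix.PosSemidef.of_dotProduct_mulVec_nonneg ?_ fun x => ?_
  · ext i j
    rw [Matrix.conjTranspose_apply, Matrix.of_apply, Matrix.of_apply]
    change (starRingEnd ℂ) _ = _
    rw [← integral_conj]
    exact integral_congr_ae (ae_of_all _ fun ω => (hM ω).1.apply i j)
  · have h : star x ⬝ᵥ (Matrix.of fun i j => ∫ ω, M ω i j ∂P).mulVec x =
        ∫ ω, star x ⬝ᵥ (M ω).mulVec x ∂P := by
      simp only [dotProduct, Matrix.mulVec, Matrix.of_apply]
      rw [integral_finsetSum _ fun i _ => (integrable_finsetSum _ fun j _ =>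
        (hint i j).mul_const _).const_mul _]
      refine Finset.sum_congr rfl fun i _ => ?_
      rw [integral_const_mul, integral_finsetSum _ fun j _ => (hint i j).mul_const _]
      simp only [integral_mul_const]
    rw [h]
    exact integral_nonneg fun ω => (hM ω).dotProduct_mulVec_nonneg x

theorem Matrix.trace_mul_eq_sum (Q Y : MatC d) :
    (Q * Y).trace = ∑ q : Fin d × Fin d, Q q.1 q.2 * Y q.2 q.1 := by
  rw [Fintype.sum_prod_type]
  rfl

variable [IsProbabilityMeasure P]

theorem trace_mul_expectedMap {Φ : Ω → QuantumChannel d} (h : Measurable Φ) (Q X : MatC d) :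
    (Q * expectedMap P (fun ω => (Φ ω).1) X).trace = ∫ ω, (Q * (Φ ω).1 X).trace ∂P := by
  simp only [Matrix.trace_mul_eq_sum, expectedMap_apply h]
  rw [integral_finsetSum _ fun q _ => (integrable_map_apply h X q.2 q.1).const_mul _]
  simp only [integral_const_mul]

theorem integrable_trace_mul {Φ : Ω → QuantumChannel d} (h : Measurable Φ) (Q X : MatC d) :
    Integrable (fun ω => (Q * (Φ ω).1 X).trace) P := by
  simp only [Matrix.trace_mul_eq_sum]
  exact integrable_finsetSum _ fun q _ => (integrable_map_apply h X q.2 q.1).const_mul _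

theorem isQuantumChannel_expectedMap {Φ : Ω → QuantumChannel d} (h : Measurable Φ) :
    IsQuantumChannel (expectedMap P fun ω => (Φ ω).1) := by
  refine ⟨fun k A hA => ?_, fun X => ?_⟩
  · convert! Matrix.posSemidef_integral (P := P)
      (M := fun ω => ampliation (Φ ω).1 k A) (fun p q => integrable_map_apply h _ _ _)
      (fun ω => (Φ ω).2.1 k A hA) using 1
    ext p q
    exact expectedMap_apply h _ _ _
  · have := trace_mul_expectedMap (P := P) h 1 X
    simp only [one_mul, (Φ _).2.2 X] at this
    simpa using this

/-! ### Uniqueness of the invariant state of the expected channel. -/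

/-- If the expected channel fixes a traceless Hermitian `H ≠ 0`, then almost every channel has an
invariant state on the positive side of `H`. -/
theorem ae_exists_isInvariantState {Φ : Ω → QuantumChannel d} (h : Measurable Φ) {H : MatC d}
    (hH : H.IsHermitian) (hH0 : H ≠ 0) (htr : H.trace = 0)
    (hfix : expectedMap P (fun ω => (Φ ω).1) H = H) :
    ∀ᵐ ω ∂P, ∃ ρ, IsInvariantState (Φ ω).1 ρ ∧ 0 < (H * ρ).trace := by
  obtain ⟨p, A, B, hdec⟩ := hH.exists_isPosNegDecomposition
  have h0 := hdec.trace_compl_mul_map_eq_zero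
    (isQuantumChannel_expectedMap (P := P) h).isPositiveTP hfix
  rw [trace_mul_expectedMap h] at h0
  have hnn : ∀ ω, 0 ≤ ((1 - p) * (Φ ω).1 p).trace := fun ω =>
    hdec.posSemidef_compl.trace_mul_nonneg ((Φ ω).2.isPositiveTP.1 _ hdec.posSemidef_proj)
  have hint := integrable_trace_mul (P := P) h (1 - p) p
  have h1 : ∫ ω, ((1 - p) * (Φ ω).1 p).trace.re ∂P = 0 := by
    have := congrArg Complex.re h0
    rwa [← RCLike.re_eq_complex_re, ← integral_re hint] at this
  -- A nonnegative variable of zero mean vanishes almost surely: this passes from the expectation to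
  -- individual channels.
  rw [integral_eq_zero_iff_of_nonneg (fun ω => (Complex.nonneg_iff.1 (hnn ω)).1) hint.re] at h1
  filter_upwards [h1] with ω hω
  refine hdec.exists_isInvariantState hH0 htr (Φ ω).2.isPositiveTP ?_
  exact Complex.ext hω (Complex.nonneg_iff.1 (hnn ω)).2.symm

theorem expectedMap_isInvariantState_unique {Φ : Ω → QuantumChannel d} (h : Measurable Φ)
    (hunique : 0 < P {ω | ∃! ρ : MatC d, IsInvariantState (Φ ω).1 ρ}) {ρ σ : MatC d}
    (hρ : IsInvariantState (expectedMap P fun ω => (Φ ω).1) ρ)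
    (hσ : IsInvariantState (expectedMap P fun ω => (Φ ω).1) σ) : ρ = σ := by
  by_contra hne
  have hherm : (ρ - σ).IsHermitian := hρ.1.1.1.sub hσ.1.1.1
  have htr : (ρ - σ).trace = 0 := by rw [Matrix.trace_sub, hρ.1.2, hσ.1.2, sub_self]
  have hfix : expectedMap P (fun ω => (Φ ω).1) (ρ - σ) = ρ - σ := by rw [map_sub, hρ.2, hσ.2]
  have h1 := ae_exists_isInvariantState h hherm (sub_ne_zero.2 hne) htr hfix
  have h2 := ae_exists_isInvariantState (H := -(ρ - σ)) h hherm.neg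
    (neg_ne_zero.2 (sub_ne_zero.2 hne))
    (by rw [Matrix.trace_neg, htr, neg_zero]) (by rw [map_neg, hfix])
  refine hunique.ne' (measure_mono_null ?_ (ae_iff.1 (h1.and h2)))
  rintro ω ⟨τ, -, hτ⟩ ⟨⟨α, hα, hα'⟩, β, hβ, hβ'⟩
  rw [hτ α hα] at hα'
  rw [hτ β hβ, neg_mul, Matrix.trace_neg, neg_pos] at hβ'
  exact lt_asymm hα' hβ'

end Expectation

/-! ### A strong law for bounded orthogonal sequences. -/

section StrongLaw

variable {Ω : Type*} [MeasurableSpace Ω] {P : Measure Ω}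

/-- The series of the `f n` has finite expectation, hence converges almost surely, so its terms tend
to zero. -/
theorem ae_tendsto_zero_of_integral_le {f : ℕ → Ω → ℝ} (hf : ∀ n, Integrable (f n) P)
    (hf0 : ∀ n ω, 0 ≤ f n ω) {b : ℕ → ℝ} (hb : Summable b) (hfb : ∀ n, ∫ ω, f n ω ∂P ≤ b n) :
    ∀ᵐ ω ∂P, Tendsto (fun n => f n ω) atTop (𝓝 0) := by
  have hb0 : ∀ n, 0 ≤ b n := fun n => (integral_nonneg (hf0 n)).trans (hfb n)
  have h1 : ∫⁻ ω, ∑' n, ENNReal.ofReal (f n ω) ∂P ≠ ⊤ := by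
    rw [lintegral_tsum fun n => (hf n).aemeasurable.ennreal_ofReal]
    have : ∀ n, ∫⁻ ω, ENNReal.ofReal (f n ω) ∂P ≤ ENNReal.ofReal (b n) := fun n => by
      rw [← ofReal_integral_eq_lintegral_ofReal (hf n) (ae_of_all _ (hf0 n))]
      exact ENNReal.ofReal_le_ofReal (hfb n)
    refine ne_top_of_le_ne_top ?_ (ENNReal.tsum_le_tsum this)
    rw [← ENNReal.ofReal_tsum_of_nonneg hb0 hb]
    exact ENNReal.ofReal_ne_top
  filter_upwards [ae_lt_top' (AEMeasurable.tsum fun n =>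
    (hf n).aemeasurable.ennreal_ofReal) h1] with ω hω
  have h2 := (ENNReal.tendsto_toReal ENNReal.zero_ne_top).comp
    (ENNReal.tendsto_atTop_zero_of_tsum_ne_top hω.ne)
  simpa [Function.comp_def, ENNReal.toReal_ofReal, hf0] using h2

variable [IsProbabilityMeasure P]

theorem integral_sq_sum_le_of_orthogonal {X : ℕ → Ω → ℝ} {C : ℝ} (hX : ∀ n, Measurable (X n))
    (hC : ∀ n ω, |X n ω| ≤ C) (horth : ∀ m n, m < n → ∫ ω, X m ω * X n ω ∂P = 0) (N : ℕ) :
    ∫ ω, (∑ n ∈ Finset.range N, X n ω) ^ 2 ∂P ≤ N * C ^ 2 := by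
  have hint : ∀ m n, Integrable (fun ω => X m ω * X n ω) P := fun m n =>
    Integrable.of_bound ((hX m).mul (hX n)).aestronglyMeasurable (C * C) (ae_of_all _ fun ω => by
      rw [Real.norm_eq_abs, abs_mul]
      exact mul_le_mul (hC m ω) (hC n ω) (abs_nonneg _) ((abs_nonneg _).trans (hC m ω)))
  simp only [sq (∑ n ∈ Finset.range N, X n _), Finset.sum_mul_sum]
  rw [integral_finsetSum _ fun m _ => integrable_finsetSum _ fun n _ => hint m n]
  simp only [integral_finsetSum _ fun n _ => hint _ n]
  have hdiag : ∀ m, ∑ n ∈ Finset.range N, ∫ ω, X m ω * X n ω ∂P ≤ C ^ 2 := by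
    intro m
    have hC2 : ∫ ω, X m ω * X m ω ∂P ≤ C ^ 2 := by
      calc ∫ ω, X m ω * X m ω ∂P ≤ ∫ _, C ^ 2 ∂P :=
            integral_mono (hint m m) (integrable_const _) fun ω => by
              change X m ω * X m ω ≤ C ^ 2
              rw [← sq]
              exact sq_le_sq' (neg_le_of_abs_le (hC m ω)) (le_of_abs_le (hC m ω))
        _ = C ^ 2 := by simp
    have h0 : ∀ n, n ≠ m → ∫ ω, X m ω * X n ω ∂P = 0 := by
      intro n hn
      rcases lt_or_gt_of_ne hn with h | h
      · rw [← horth n m h]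
        simp only [mul_comm]
      · exact horth m n h
    calc ∑ n ∈ Finset.range N, ∫ ω, X m ω * X n ω ∂P
        ≤ ∑ n ∈ Finset.range N, if n = m then C ^ 2 else 0 := Finset.sum_le_sum fun n _ => by
          split_ifs with h
          · rw [h]; exact hC2
          · exact (h0 n h).le
      _ ≤ C ^ 2 := by
          rw [Finset.sum_ite_eq']
          split_ifs
          · exact le_rfl
          · exact sq_nonneg C
  calc _ ≤ ∑ _m ∈ Finset.range N, C ^ 2 := Finset.sum_le_sum fun m _ => hdiag m
    _ = N * C ^ 2 := by simp

/-- Averages along the squares control all averages of a bounded sequence. -/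
theorem tendsto_average_of_tendsto_sq {x : ℕ → ℝ} {C : ℝ} (hC : ∀ n, |x n| ≤ C)
    (h : Tendsto (fun k : ℕ => (∑ n ∈ Finset.range ((k + 1) ^ 2), x n) / ((k + 1) ^ 2 : ℕ))
      atTop (𝓝 0)) :
    Tendsto (fun N : ℕ => (∑ n ∈ Finset.range N, x n) / N) atTop (𝓝 0) := by
  -- Adding `C` makes the summands nonnegative, hence the partial sums monotone; consecutive squares
  -- have ratio tending to 1, so the subsequence suffices.
  have hmain : Tendsto (fun N : ℕ => (∑ n ∈ Finset.range N, (x n + C)) / N) atTop (𝓝 C) := by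
    refine tendsto_div_of_monotone_of_exists_subseq_tendsto_div _ C ?_ fun a ha =>
      ⟨fun k => (k + 1) ^ 2, ?_, ?_, ?_⟩
    · refine monotone_nat_of_le_succ fun n => ?_
      rw [Finset.sum_range_succ]
      linarith [neg_le_of_abs_le (hC n)]
    · have h1 : Tendsto (fun k : ℕ => (1 + 1 / ((k : ℝ) + 1)) ^ 2) atTop (𝓝 ((1 + 0) ^ 2)) :=
        (tendsto_const_nhds.add tendsto_one_div_add_atTop_nhds_zero_nat).pow 2
      rw [add_zero, one_pow] at h1
      filter_upwards [h1.eventually_le_const ha] with k hk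
      push_cast
      calc ((k : ℝ) + 1 + 1) ^ 2 = (1 + 1 / ((k : ℝ) + 1)) ^ 2 * (k + 1) ^ 2 := by field_simp
        _ ≤ _ := mul_le_mul_of_nonneg_right hk (by positivity)
    · exact (tendsto_pow_atTop two_ne_zero).comp (tendsto_add_atTop_nat 1)
    · have h2 := h.add_const C
      rw [zero_add] at h2
      refine h2.congr fun k => ?_
      have : (((k + 1) ^ 2 : ℕ) : ℝ) ≠ 0 := by positivity
      rw [Finset.sum_add_distrib, Finset.sum_const, Finset.card_range, nsmul_eq_mul, add_div,
        mul_div_cancel_left₀ _ this]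
  have h3 := hmain.sub_const C
  rw [sub_self] at h3
  refine h3.congr' ?_
  filter_upwards [eventually_ne_atTop 0] with N hN
  have : (N : ℝ) ≠ 0 := by exact_mod_cast hN
  rw [Finset.sum_add_distrib, Finset.sum_const, Finset.card_range, nsmul_eq_mul, add_div,
    mul_div_cancel_left₀ _ this, add_sub_cancel_right]

/-- The strong law of large numbers for bounded orthogonal sequences. -/
theorem ae_tendsto_average_of_orthogonal {X : ℕ → Ω → ℝ} {C : ℝ} (hX : ∀ n, Measurable (X n))
    (hC : ∀ n ω, |X n ω| ≤ C) (horth : ∀ m n, m < n → ∫ ω, X m ω * X n ω ∂P = 0) :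
    ∀ᵐ ω ∂P, Tendsto (fun N : ℕ => (∑ n ∈ Finset.range N, X n ω) / N) atTop (𝓝 0) := by
  -- Orthogonality bounds the second moment of the average of N terms by C²/N, which is summable
  -- along squares; the shift to `k + 1` avoids an empty average.
  let f : ℕ → Ω → ℝ := fun k ω =>
    ((∑ n ∈ Finset.range ((k + 1) ^ 2), X n ω) / ((k + 1) ^ 2 : ℕ)) ^ 2
  have hsum : Summable fun k : ℕ => C ^ 2 * (1 / ((k + 1 : ℕ) : ℝ) ^ 2) :=
    ((summable_nat_add_iff 1).2 (Real.summable_one_div_nat_pow.2 one_lt_two)).mul_left _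
  have hbound : ∀ N ω, |∑ n ∈ Finset.range N, X n ω| ≤ N * C := fun N ω => by
    refine (Finset.abs_sum_le_sum_abs _ _).trans ((Finset.sum_le_sum fun n _ => hC n ω).trans ?_)
    simp
  have hint : ∀ k, Integrable (f k) P := fun k => by
    refine Integrable.of_bound (C := C ^ 2) (Measurable.aestronglyMeasurable ?_)
      (ae_of_all _ fun ω => ?_)
    · exact ((Finset.measurable_fun_sum _ fun n _ => hX n).div_const _).pow_const 2
    · have hpos : (0 : ℝ) < ((k + 1) ^ 2 : ℕ) := by positivity
      rw [Real.norm_eq_abs, abs_pow, abs_div, abs_of_pos hpos]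
      refine pow_le_pow_left₀ (by positivity) ?_ 2
      rw [div_le_iff₀ hpos, mul_comm]
      exact hbound _ ω
  have hle : ∀ k, ∫ ω, f k ω ∂P ≤ C ^ 2 * (1 / ((k + 1 : ℕ) : ℝ) ^ 2) := fun k => by
    simp only [f, div_pow, integral_div]
    have h1 := integral_sq_sum_le_of_orthogonal (P := P) hX hC horth ((k + 1) ^ 2)
    refine (div_le_div_of_nonneg_right h1 (by positivity)).trans (le_of_eq ?_)
    push_cast
    field_simp
  filter_upwards [ae_tendsto_zero_of_integral_le hint (fun k ω => sq_nonneg _) hsum hle] with ω hω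
  refine tendsto_average_of_tendsto_sq (fun n => hC n ω) ?_
  have h2 := hω.sqrt
  simp only [f, Real.sqrt_sq_eq_abs, Real.sqrt_zero] at h2
  exact (tendsto_zero_iff_abs_tendsto_zero _).2 h2

end StrongLaw

section StrongLaw

variable {Ω : Type*} [MeasurableSpace Ω] {P : Measure Ω} [IsProbabilityMeasure P]

/-- Real and imaginary parts are treated separately, so real weights are what is required: the real
part of `hre` and the imaginary part of `him` are the two real orthogonality relations. -/
theorem ae_tendsto_average_of_orthogonal_complex {D : ℕ → Ω → ℂ} {C : ℝ}
    (hD : ∀ n, Measurable (D n)) (hC : ∀ n ω, ‖D n ω‖ ≤ C)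
    (hre : ∀ m n, m < n → ∫ ω, ((D m ω).re : ℂ) * D n ω ∂P = 0)
    (him : ∀ m n, m < n → ∫ ω, ((D m ω).im : ℂ) * D n ω ∂P = 0) :
    ∀ᵐ ω ∂P, Tendsto (fun N : ℕ => (N : ℂ)⁻¹ * ∑ n ∈ Finset.range N, D n ω) atTop (𝓝 0) := by
  have hint : ∀ (g : Ω → ℝ) (n : ℕ), Measurable g → (∀ ω, |g ω| ≤ C) →
      Integrable (fun ω => (g ω : ℂ) * D n ω) P := fun g n hg hgC =>
    integrable_of_bounded ((Complex.measurable_ofReal.comp hg).mul (hD n)) (C := C * C)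
      fun ω => by
        rw [norm_mul, Complex.norm_real]
        exact mul_le_mul (hgC ω) (hC n ω) (norm_nonneg _) ((abs_nonneg _).trans (hgC ω))
  have hmre : ∀ n, Measurable fun ω => (D n ω).re := fun n => Complex.measurable_re.comp (hD n)
  have hmim : ∀ n, Measurable fun ω => (D n ω).im := fun n => Complex.measurable_im.comp (hD n)
  have hCre : ∀ n ω, |(D n ω).re| ≤ C := fun n ω => (Complex.abs_re_le_norm _).trans (hC n ω)
  have hCim : ∀ n ω, |(D n ω).im| ≤ C := fun n ω => (Complex.abs_im_le_norm _).trans (hC n ω)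
  have h1 := ae_tendsto_average_of_orthogonal (P := P) hmre hCre fun m n hmn => by
    have := integral_re (hint _ n (hmre m) (hCre m))
    rw [hre m n hmn] at this
    simpa using this
  have h2 := ae_tendsto_average_of_orthogonal (P := P) hmim hCim fun m n hmn => by
    have := integral_im (hint _ n (hmim m) (hCim m))
    rw [him m n hmn] at this
    simpa using this
  filter_upwards [h1, h2] with ω hω1 hω2
  have h3 := ((Complex.continuous_ofReal.tendsto 0).comp hω1).add
    (((Complex.continuous_ofReal.tendsto 0).comp hω2).mul_const Complex.I)
  simp only [Complex.ofReal_zero, zero_mul, add_zero] at h3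
  refine h3.congr fun N => ?_
  have h4 : ∑ n ∈ Finset.range N, D n ω =
      ((∑ n ∈ Finset.range N, (D n ω).re : ℝ) : ℂ) +
        ((∑ n ∈ Finset.range N, (D n ω).im : ℝ) : ℂ) * Complex.I := by
    rw [Complex.ofReal_sum, Complex.ofReal_sum, Finset.sum_mul, ← Finset.sum_add_distrib]
    exact Finset.sum_congr rfl fun n _ => (Complex.re_add_im _).symm
  rw [h4]
  simp only [Function.comp, Complex.ofReal_div, Complex.ofReal_natCast]
  ring

end StrongLaw

/-! ### Innovations and their orthogonality to the past. -/

theorem measurable_composeFirst_apply {d : ℕ} {Ω : Type*} {m : MeasurableSpace Ω}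
    {Φ : ℕ → Ω → QuantumChannel d} {n : ℕ} (h : ∀ k < n, Measurable[m] (Φ k)) (X : MatC d)
    (i j : Fin d) : Measurable[m] fun ω => composeFirst (fun k => (Φ k ω).1) n X i j := by
  induction n generalizing i j with
  | zero => exact measurable_const
  | succ n ih =>
    have h1 : (fun ω => composeFirst (fun k => (Φ k ω).1) (n + 1) X i j) = fun ω =>
        ∑ q : Fin d × Fin d, composeFirst (fun k => (Φ k ω).1) n X q.1 q.2 *
          (Φ n ω).1 (Matrix.stdBasis ℂ (Fin d) (Fin d) q) i j :=
      funext fun ω =>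
        Matrix.linearMap_apply_eq_sum (Φ n ω).1 (composeFirst (fun k => (Φ k ω).1) n X) i j
    rw [h1]
    exact Finset.measurable_fun_sum _ fun q _ =>
      (ih (fun k hk => h k (hk.trans n.lt_succ_self)) q.1 q.2).mul
        (measurable_map_apply (h n n.lt_succ_self) _ i j)

/-- The difference between the next state and its conditional expectation. -/
noncomputable def innovation {d : ℕ} {Ω : Type*} [MeasurableSpace Ω] (P : Measure Ω)
    (Φ : ℕ → Ω → QuantumChannel d) (X : MatC d)
    (i j : Fin d) (n : ℕ) (ω : Ω) : ℂ :=
  composeFirst (fun k => (Φ k ω).1) (n + 1) X i j -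
    expectedMap P (fun ω => (Φ 0 ω).1) (composeFirst (fun k => (Φ k ω).1) n X) i j

/-- Each summand separates a factor depending on the first `n` channels from a factor depending only
on `Φ n`, which is centred once the laws agree. -/
theorem innovation_eq_sum {d : ℕ} {Ω : Type*} [MeasurableSpace Ω] {P : Measure Ω}
    {Φ : ℕ → Ω → QuantumChannel d} (X : MatC d) (i j : Fin d) (n : ℕ) (ω : Ω) :
    innovation P Φ X i j n ω = ∑ q : Fin d × Fin d,
      composeFirst (fun k => (Φ k ω).1) n X q.1 q.2 *
        ((Φ n ω).1 (Matrix.stdBasis ℂ (Fin d) (Fin d) q) i j -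
          expectedMap P (fun ω => (Φ 0 ω).1) (Matrix.stdBasis ℂ (Fin d) (Fin d) q) i j) := by
  simp only [mul_sub, Finset.sum_sub_distrib, ← Matrix.linearMap_apply_eq_sum]
  rfl

theorem measurable_innovation {d : ℕ} {Ω : Type*} {m mΩ : MeasurableSpace Ω} {P : Measure Ω}
    {Φ : ℕ → Ω → QuantumChannel d} {n : ℕ}
    (h : ∀ k < n + 1, Measurable[m] (Φ k)) (X : MatC d) (i j : Fin d) :
    Measurable[m] (innovation P Φ X i j n) := by
  refine (measurable_composeFirst_apply h X i j).sub ?_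
  have h1 : (fun ω => expectedMap P (fun ω => (Φ 0 ω).1)
      (composeFirst (fun k => (Φ k ω).1) n X) i j) = _ :=
    funext fun ω => Matrix.linearMap_apply_eq_sum (expectedMap P fun ω => (Φ 0 ω).1)
      (composeFirst (fun k => (Φ k ω).1) n X) i j
  rw [h1]
  exact Finset.measurable_fun_sum _ fun q _ =>
    (measurable_composeFirst_apply (fun k hk => h k (hk.trans n.lt_succ_self)) X _ _).mul_const _

theorem innovation_apply_eq_sum {d : ℕ} {Ω : Type*} [MeasurableSpace Ω] {P : Measure Ω}
    {Φ : ℕ → Ω → QuantumChannel d} (X : MatC d) (i j : Fin d) (n : ℕ) (ω : Ω) :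
    innovation P Φ X i j n ω = ∑ q : Fin d × Fin d, X q.1 q.2 *
      innovation P Φ (Matrix.stdBasis ℂ (Fin d) (Fin d) q) i j n ω :=
  Matrix.linearMap_apply_eq_sum (composeFirst (fun k => (Φ k ω).1) (n + 1) -
    expectedMap P (fun ω => (Φ 0 ω).1) ∘ₗ composeFirst (fun k => (Φ k ω).1) n) X i j

/-- The `σ`-algebra generated by the first `n` channels. -/
noncomputable abbrev pastChannels {d : ℕ} {Ω : Type*} (Φ : ℕ → Ω → QuantumChannel d)
    (n : ℕ) : MeasurableSpace Ω :=
  ⨆ i ∈ Set.Iio n, MeasurableSpace.comap (Φ i) inferInstance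

theorem measurable_pastChannels {d : ℕ} {Ω : Type*} {Φ : ℕ → Ω → QuantumChannel d} {k n : ℕ}
    (h : k < n) : Measurable[pastChannels Φ n] (Φ k) :=
  measurable_iff_comap_le.2 (le_iSup₂_of_le k h le_rfl)

section Convergence

variable {d : ℕ} {Ω : Type*} [MeasurableSpace Ω] {P : Measure Ω}
  {Φ : ℕ → Ω → QuantumChannel d}

theorem pastChannels_le (hmeas : ∀ n, Measurable (Φ n)) (n : ℕ) :
    pastChannels Φ n ≤ (inferInstance : MeasurableSpace Ω) :=
  iSup₂_le fun i _ => (hmeas i).comap_le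

theorem indep_pastChannels (hmeas : ∀ n, Measurable (Φ n)) (hindep : iIndepFun Φ P) (n : ℕ) :
    Indep (pastChannels Φ n) (MeasurableSpace.comap (Φ n) inferInstance) P := by
  have := indep_iSup_of_disjoint (fun i => (hmeas i).comap_le) hindep
    (S := Set.Iio n) (T := {n}) (by simp)
  rwa [iSup_singleton] at this

variable [IsProbabilityMeasure P]

theorem exists_norm_innovation_le (hmeas : ∀ n, Measurable (Φ n)) (X : MatC d) :
    ∃ C : ℝ, ∀ i j n ω, ‖innovation P Φ X i j n ω‖ ≤ C := by
  obtain ⟨C, hC⟩ := exists_forall_norm_apply_le X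
  have hΦ : ∀ n ω, IsPositiveTP (composeFirst (fun k => (Φ k ω).1) n) := fun n ω =>
    .composeFirst (fun k => (Φ k ω).2.isPositiveTP) n
  have hE := (isQuantumChannel_expectedMap (P := P) (hmeas 0)).isPositiveTP
  refine ⟨C + C, fun i j n ω => (norm_sub_le _ _).trans (add_le_add ?_ ?_)⟩
  · exact hC _ (hΦ (n + 1) ω) i j
  · exact hC _ (hE.comp (hΦ n ω)) i j

/-- The martingale difference property, tested against bounded past variables: in the expansion, `V
q` is past-measurable while `Y q` is a centred function of the independent channel `Φ n`, so each
product has zero mean. -/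
theorem integral_mul_innovation (hmeas : ∀ n, Measurable (Φ n)) (hindep : iIndepFun Φ P)
    (hident : ∀ n, IdentDistrib (Φ n) (Φ 0) P P) (X : MatC d) (i j : Fin d) (n : ℕ) {W : Ω → ℂ}
    (hW : Measurable[pastChannels Φ n] W) {C : ℝ} (hC : ∀ ω, ‖W ω‖ ≤ C) :
    ∫ ω, W ω * innovation P Φ X i j n ω ∂P = 0 := by
  let b := Matrix.stdBasis ℂ (Fin d) (Fin d)
  let V : Fin d × Fin d → Ω → ℂ := fun q ω =>
    W ω * composeFirst (fun k => (Φ k ω).1) n X q.1 q.2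
  let Y : Fin d × Fin d → Ω → ℂ := fun q ω =>
    (Φ n ω).1 (b q) i j - expectedMap P (fun ω => (Φ 0 ω).1) (b q) i j
  have hV : ∀ q, Measurable[pastChannels Φ n] (V q) := fun q =>
    hW.mul (measurable_composeFirst_apply (fun k hk => measurable_pastChannels hk) X _ _)
  have hY : ∀ q, Measurable[MeasurableSpace.comap (Φ n) inferInstance] (Y q) := fun q =>
    (measurable_map_apply (comap_measurable (Φ n)) _ i j).sub_const _
  have hV' : ∀ q, Measurable (V q) := fun q => (hV q).mono (pastChannels_le hmeas n) le_rfl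
  have hY' : ∀ q, Measurable (Y q) := fun q => (hY q).mono (hmeas n).comap_le le_rfl
  have hind : ∀ q, IndepFun (V q) (Y q) P := fun q => by
    rw [IndepFun_iff_Indep]
    exact indep_of_indep_of_le_left (indep_of_indep_of_le_right (indep_pastChannels hmeas hindep n)
      (hY q).comap_le) (hV q).comap_le
  have hVint : ∀ q, Integrable (V q) P := fun q => by
    obtain ⟨K, hK⟩ := exists_forall_norm_apply_le X
    refine integrable_of_bounded (hV' q) (C := C * K) fun ω => ?_
    rw [norm_mul]
    exact mul_le_mul (hC ω) (hK _ (.composeFirst (fun k => (Φ k ω).2.isPositiveTP) n) _ _)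
      (norm_nonneg _) ((norm_nonneg _).trans (hC ω))
  have hYint : ∀ q, Integrable (Y q) P := fun q =>
    (integrable_map_apply (hmeas n) _ i j).sub (integrable_const _)
  have hYzero : ∀ q, ∫ ω, Y q ω ∂P = 0 := fun q => by
    have h1 : ∫ ω, (Φ n ω).1 (b q) i j ∂P = ∫ ω, (Φ 0 ω).1 (b q) i j ∂P :=
      ((hident n).comp (measurable_map_apply measurable_id (b q) i j)).integral_eq
    rw [integral_sub (integrable_map_apply (hmeas n) _ i j) (integrable_const _), h1,
      expectedMap_apply (hmeas 0)]
    simp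
  have hsum : ∀ ω, W ω * innovation P Φ X i j n ω = ∑ q, V q ω * Y q ω := fun ω => by
    rw [innovation_eq_sum, Finset.mul_sum]
    exact Finset.sum_congr rfl fun q _ => (mul_assoc _ _ _).symm
  simp only [hsum]
  have hVY : ∀ q, Integrable (fun ω => V q ω * Y q ω) P := fun q =>
    (hind q).integrable_mul (hVint q) (hYint q)
  rw [integral_finsetSum _ fun q _ => hVY q]
  refine Finset.sum_eq_zero fun q _ => ?_
  rw [(hind q).integral_fun_mul_eq_mul_integral (hV' q).aestronglyMeasurable
    (hY' q).aestronglyMeasurable, hYzero, mul_zero]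

theorem ae_tendsto_average_innovation (hmeas : ∀ n, Measurable (Φ n)) (hindep : iIndepFun Φ P)
    (hident : ∀ n, IdentDistrib (Φ n) (Φ 0) P P) (X : MatC d) (i j : Fin d) :
    ∀ᵐ ω ∂P, Tendsto (fun N : ℕ => (N : ℂ)⁻¹ * ∑ n ∈ Finset.range N, innovation P Φ X i j n ω)
      atTop (𝓝 0) := by
  obtain ⟨C, hC⟩ := exists_norm_innovation_le (P := P) hmeas X
  have hm : ∀ m n, m < n → Measurable[pastChannels Φ n] (innovation P Φ X i j m) :=
    fun m n hmn => measurable_innovation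
      (fun k hk => measurable_pastChannels ((Nat.lt_succ_iff.1 hk).trans_lt hmn)) X i j
  refine ae_tendsto_average_of_orthogonal_complex
    (fun n => measurable_innovation (fun k _ => hmeas k) X i j) (hC i j) (fun m n hmn => ?_)
    fun m n hmn => ?_
  · refine integral_mul_innovation hmeas hindep hident X i j n
      (Complex.measurable_ofReal.comp (Complex.measurable_re.comp (hm m n hmn))) (C := C)
      fun ω => ?_
    rw [Complex.norm_real]
    exact (Complex.abs_re_le_norm _).trans (hC i j m ω)
  · refine integral_mul_innovation hmeas hindep hident X i j n
      (Complex.measurable_ofReal.comp (Complex.measurable_im.comp (hm m n hmn))) (C := C)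
      fun ω => ?_
    rw [Complex.norm_real]
    exact (Complex.abs_im_le_norm _).trans (hC i j m ω)

/-- Innovations are linear in `X`, so the finitely many matrix units yield one null set valid for
all initial matrices. -/
theorem ae_forall_tendsto_average_innovation (hmeas : ∀ n, Measurable (Φ n))
    (hindep : iIndepFun Φ P) (hident : ∀ n, IdentDistrib (Φ n) (Φ 0) P P) :
    ∀ᵐ ω ∂P, ∀ (X : MatC d) (i j : Fin d),
      Tendsto (fun N : ℕ => (N : ℂ)⁻¹ * ∑ n ∈ Finset.range N, innovation P Φ X i j n ω)
        atTop (𝓝 0) := by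
  have h := ae_all_iff.2 fun q => ae_all_iff.2 fun i => ae_all_iff.2 fun j =>
    ae_tendsto_average_innovation hmeas hindep hident (Matrix.stdBasis ℂ (Fin d) (Fin d) q) i j
  filter_upwards [h] with ω hω X i j
  have h1 := tendsto_finsetSum Finset.univ fun q (_ : q ∈ Finset.univ) =>
    (hω q i j).const_mul (X q.1 q.2)
  simp only [mul_zero, Finset.sum_const_zero] at h1
  refine h1.congr fun N => ?_
  simp only [innovation_apply_eq_sum X, Finset.mul_sum]
  rw [Finset.sum_comm]
  exact Finset.sum_congr rfl fun _ _ => Finset.sum_congr rfl fun _ _ => by ring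

/-- Along a trajectory with vanishing averaged innovations, the averages of the states are
asymptotically invariant under the expected channel. -/
theorem tendsto_average_sub_map (hmeas : ∀ n, Measurable (Φ n)) {ω : Ω} (X : MatC d)
    (h : ∀ i j, Tendsto (fun N : ℕ => (N : ℂ)⁻¹ *
      ∑ n ∈ Finset.range N, innovation P Φ X i j n ω) atTop (𝓝 0)) :
    Tendsto (fun N : ℕ =>
      ((N : ℂ)⁻¹ • ∑ n ∈ Finset.Icc 1 N, composeFirst (fun k => (Φ k ω).1) n X) -
        expectedMap P (fun ω => (Φ 0 ω).1)
          ((N : ℂ)⁻¹ • ∑ n ∈ Finset.Icc 1 N, composeFirst (fun k => (Φ k ω).1) n X))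
      atTop (𝓝 0) := by
  set E := expectedMap P fun ω => (Φ 0 ω).1
  set L := fun n => composeFirst (fun k => (Φ k ω).1) n X
  obtain ⟨C, hC⟩ := exists_forall_norm_apply_le X
  have hE : IsPositiveTP E := (isQuantumChannel_expectedMap (P := P) (hmeas 0)).isPositiveTP
  have hL : ∀ n, IsPositiveTP (composeFirst (fun k => (Φ k ω).1) n) :=
    .composeFirst fun k => (Φ k ω).2.isPositiveTP
  have hinn : Tendsto (fun N : ℕ => (N : ℂ)⁻¹ • ∑ n ∈ Finset.range N, (L (n + 1) - E (L n)))
      atTop (𝓝 0) := by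
    refine tendsto_pi_nhds.2 fun i => tendsto_pi_nhds.2 fun j => (h i j).congr fun N => ?_
    rw [Matrix.smul_apply, Matrix.sum_apply]
    rfl
  -- The averages run over times 1 to N, but innovations apply E to times 0 to N - 1; this is the
  -- vanishing boundary correction.
  have hbdry := tendsto_inv_smul_of_bounded (X := fun N => E (L 0) - E (L N)) (C := C + C)
    fun n i j => (norm_sub_le _ _).trans
      (add_le_add (hC _ (hE.comp (hL 0)) i j) (hC _ (hE.comp (hL n)) i j))
  have h0 := hinn.add hbdry
  rw [add_zero] at h0
  refine h0.congr fun N => ?_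
  have hIcc : ∑ n ∈ Finset.Icc 1 N, L n = ∑ n ∈ Finset.range N, L (n + 1) := by
    rw [Finset.range_eq_Ico, Finset.sum_Ico_add' L 0 N 1]
    rfl
  rw [hIcc, map_smul, map_sum, ← smul_sub, ← smul_add, Finset.sum_sub_distrib]
  congr 1
  have := Finset.sum_range_sub' (fun n => E (L n)) N
  rw [← this, Finset.sum_sub_distrib]
  abel

end Convergence

theorem mainTheorem2 {d : ℕ} {Ω : Type*} [MeasurableSpace Ω] (P : Measure Ω)
    [IsProbabilityMeasure P] (Φ : ℕ → Ω → QuantumChannel d)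
    (hmeas : ∀ n, Measurable (Φ n))
    (hindep : iIndepFun Φ P)
    (hident : ∀ n, IdentDistrib (Φ n) (Φ 0) P P)
    (hunique : 0 < P {ω | ∃! ρ : MatC d, IsInvariantState (Φ 0 ω).1 ρ}) :
    (∀ (X : MatC d) (i j : Fin d), Integrable (fun ω => (Φ 0 ω).1 X i j) P) ∧
    IsQuantumChannel (expectedMap P fun ω => (Φ 0 ω).1) ∧
    ∃ θ : MatC d,
      IsInvariantState (expectedMap P fun ω => (Φ 0 ω).1) θ ∧
      (∀ ρ : MatC d, IsInvariantState (expectedMap P fun ω => (Φ 0 ω).1) ρ → ρ = θ) ∧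
      ∀ᵐ ω ∂P, ∀ ρ₀ : MatC d, IsDensityMatrix ρ₀ →
        Tendsto
          (fun N : ℕ => (N : ℂ)⁻¹ •
            ∑ n ∈ Finset.Icc 1 N, composeFirst (fun k => (Φ k ω).1) n ρ₀)
          atTop (𝓝 θ) := by
  have hE := isQuantumChannel_expectedMap (P := P) (hmeas 0)
  -- Positive probability provides at least one density matrix, to start an orbit of the expected
  -- channel; the constraint `Q = 0` below is vacuous.
  obtain ⟨ω₀, ρ, hρ, -⟩ := nonempty_of_measure_ne_zero hunique.ne'
  obtain ⟨θ, hθ, -⟩ := exists_isInvariantState_of_orbit hE.isPositiveTP hρ.1 0 (by simp)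
  have huniq : ∀ ρ : MatC d, IsInvariantState (expectedMap P fun ω => (Φ 0 ω).1) ρ → ρ = θ :=
    fun ρ hρ => expectedMap_isInvariantState_unique (hmeas 0) hunique hρ hθ
  refine ⟨fun X i j => integrable_map_apply (hmeas 0) X i j, hE, θ, hθ, huniq, ?_⟩
  filter_upwards [ae_forall_tendsto_average_innovation hmeas hindep hident] with ω hω ρ₀ hρ₀
  -- In a compact set, a sequence with a single possible cluster point converges to it.
  refine isCompact_isDensityMatrix.tendsto_nhds_of_unique_mapClusterPt ?_ fun σ hσ hcl =>
    huniq σ ⟨hσ, map_eq_of_mapClusterPt (tendsto_average_sub_map hmeas ρ₀ (hω ρ₀)) hcl⟩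
  filter_upwards [eventually_ge_atTop 1] with N hN
  have h := isDensityMatrix_average (fun n => (IsPositiveTP.composeFirst
    (fun k => (Φ k ω).2.isPositiveTP) n).isDensityMatrix hρ₀) (Finset.Icc 1 N)
    (Finset.nonempty_Icc.2 hN)
  simpa using h
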